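/- Let $m\ge 1$ be an integer, let $h>0$ and $\sigma$ be real numbers. Let $E_k$ denote the Euler--Frobenius polynomial of degree $k$, defined by $$\Bigl(x\frac{d}{dx}\Bigr)^k\frac{x}{(1-x)^2}=\frac{x\,E_k(x)}{(1-x)^{k+2}},$$ equivalently by $E_0=1$ and $E_{k+1}(x)=(1+(k+1)x)E_k(x)+x(1-x)E_k'(x)$, and let $q_1,\dots,q_{m-1}$ be the roots of $E_{2m-2}$ with $|q_k|<1$. For $\beta\in\mathbb Z$ put $$D_h^{(m)}[\beta]=\frac{(2m-1)!}{h^{2m}}\begin{cases}\displaystyle\sum_{k=1}^{m-1}\frac{(1-q_k)^{2m+1}q_k^{|\beta|}}{q_k\,E_{2m-1}(q_k)},&|\beta|\ge 2,\\[2mm] \displaystyle 1+\sum_{k=1}^{m-1}\frac{(1-q_k)^{2m+1}}{E_{2m-1}(q_k)},&|\beta|=1,\\[2mm] \displaystyle -2^{2m-1}+\sum_{k=1}^{m-1}\frac{(1-q_k)^{2m+1}}{q_k\,E_{2m-1}(q_k)},&\beta=0,\end{cases}$$ and for functions $f,g$ on $\mathbb Z$ let $f[\beta]*g[\beta]=\sum_{\gamma\in\mathbb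 Z}f[\gamma]\,g[\beta-\gamma]$. Then for every $\beta\in\mathbb Z$ the series defining $D_h^{(m)}[\beta]*e^{2\pi i\sigma h\beta}$ converges absolutely, and: (i) if $\sigma h\notin\mathbb Z$, then $\sum_{\gamma\in\mathbb Z}\frac{h^{2m}}{(\gamma-\sigma h)^{2m}}$ converges and $$D_h^{(m)}[\beta]*e^{2\pi i\sigma h\beta}=(-1)^m(2\pi)^{2m}\,e^{2\pi i\sigma h\beta}\Bigl[\sum_{\gamma\in\mathbb Z}\frac{h^{2m}}{(\gamma-\sigma h)^{2m}}\Bigr]^{-1};$$ (ii) if $\sigma h\in\mathbb Z$, then $D_h^{(m)}[\beta]*e^{2\pi i\sigma h\beta}=0$. -/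

import Mathlib

/-- The Euler-Frobenius polynomial `E_k`, of degree `k`: `E_0 = 1` and
`E_{k+1} = (1 + (k+1) x) E_k + x (1 - x) E_k'`.
It is the polynomial with `(x d/dx)^k (x / (1-x)^2) = x E_k(x) / (1-x)^(k+2)`,
see `eulerFrobenius_spec`. -/
noncomputable def eulerFrobenius : ℕ → Polynomial ℤ
  | 0 => 1
  | k + 1 =>
      (1 + ((k : Polynomial ℤ) + 1) * Polynomial.X) * eulerFrobenius k
        + Polynomial.X * (1 - Polynomial.X) * Polynomial.derivative (eulerFrobenius k)

/-- The usual description of `E_k`, by iterating `x d/dx` on `x / (1-x)^2`. -/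
theorem eulerFrobenius_spec (k : ℕ) (x : ℂ) (hx : x ≠ 1) :
    (fun (f : ℂ → ℂ) (y : ℂ) => y * deriv f y)^[k] (fun y => y / (1 - y) ^ 2) x
      = x * Polynomial.aeval x (eulerFrobenius k) / (1 - x) ^ (k + 2) := by
  induction k generalizing x with
  | zero => simp [eulerFrobenius]
  | succ k ih =>
    rw [Function.iterate_succ_apply']
    have hne : (1 - x) ≠ 0 := sub_ne_zero.mpr (Ne.symm hx)
    have hev : (fun (f : ℂ → ℂ) (y : ℂ) => y * deriv f y)^[k] (fun y => y / (1 - y) ^ 2)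
        =ᶠ[nhds x] fun y => y * Polynomial.aeval y (eulerFrobenius k) / (1 - y) ^ (k + 2) := by
      filter_upwards [isOpen_ne.mem_nhds hx] with y hy using ih y hy
    have h1 : HasDerivAt (fun y : ℂ => (1 - y) ^ (k + 2))
        (((k + 2 : ℕ) : ℂ) * (1 - x) ^ (k + 1) * (-1)) x := by
      exact ((hasDerivAt_id x).const_sub 1).pow (k + 2)
    have h2 := ((hasDerivAt_id x).mul
      (Polynomial.hasDerivAt_aeval (eulerFrobenius k) x)).div h1 (pow_ne_zero _ hne)
    have h3 := h2.deriv
    simp only [id_eq] at h3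
    rw [hev.deriv_eq]
    have h4 : deriv (fun y => y * Polynomial.aeval y (eulerFrobenius k) / (1 - y) ^ (k + 2)) x
      = _ := h3
    rw [h4]
    simp only [eulerFrobenius, Pi.mul_apply, id_eq, map_add, map_mul, map_sub, map_one,
      Polynomial.aeval_X, map_natCast]
    push_cast
    field_simp
    ring

/-- The roots `q_1, …, q_{m-1}` of `E_{2m-2}` that lie in the open unit disc. -/
noncomputable def innerRoots (m : ℕ) : Finset ℂ :=
  {q ∈ ((eulerFrobenius (2 * m - 2)).aroots ℂ).toFinset | ‖q‖ < 1}

/-- The discrete analogue `D_h^{(m)}[β]` of the operator `d^{2m}/dx^{2m}`, for `m ≥ 1`. -/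
noncomputable def discreteD (m : ℕ) (h : ℝ) (β : ℤ) : ℂ :=
  ((2 * m - 1).factorial : ℂ) / (h : ℂ) ^ (2 * m) *
    if β = 0 then
      -2 ^ (2 * m - 1) + ∑ q ∈ innerRoots m,
        (1 - q) ^ (2 * m + 1) / (q * Polynomial.aeval q (eulerFrobenius (2 * m - 1)))
    else if |β| = 1 then
      1 + ∑ q ∈ innerRoots m,
        (1 - q) ^ (2 * m + 1) / Polynomial.aeval q (eulerFrobenius (2 * m - 1))
    else
      ∑ q ∈ innerRoots m,
        (1 - q) ^ (2 * m + 1) * q ^ β.natAbs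
          / (q * Polynomial.aeval q (eulerFrobenius (2 * m - 1)))

/-- The convolution `f[β] * g[β] = ∑_γ f[γ] g[β - γ]` of functions of a discrete argument. -/
noncomputable def discreteConv (f g : ℤ → ℂ) (β : ℤ) : ℂ :=
  ∑' γ : ℤ, f γ * g (β - γ)

/-- The discrete function `β ↦ exp (2πiσhβ)`. -/
noncomputable def discreteExp (σ h : ℝ) (β : ℤ) : ℂ :=
  Complex.exp (2 * (Real.pi : ℂ) * Complex.I * (σ : ℂ) * (h : ℂ) * (β : ℂ))

/-!
Put `μ = exp (-2πiσh)` and `k = 2m - 2`. Factoring `exp (2πiσhβ)` out of the convolution leaves the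
Fourier series `∑ D[γ] μ ^ γ`, and both sides are computed from the rational function
`(1 - μ) ^ (2m) / (μ E_k(μ))`.

* The series. The polynomial part of `(1 - X) ^ (2m) / (X E_k)` is read off from the two leading
  coefficients of `E_k`, and the residue at `0` from `E_k(0) = 1`. As `E_k` has only simple roots
  (`card_aroots_eulerFrobenius`), Lagrange interpolation at `0` and at these roots gives its partial
  fractions (`partialFraction_eulerFrobenius`). `E_k` is palindromic, so the roots off the unit
  circle come in pairs `q`, `1 / q`; the two terms of a pair add up to a multiple of a Poisson
  kernel, which is the generating series of `q ^ |γ|`. This is `hasSum_discreteD_mul_zpow`: the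
  coefficients of the rational function on the unit circle are those of `D`.

* Simplicity of the roots. In the variable `y = (1 + x) / (1 - x)` the recursion becomes
  `P_{k+1} = ((y² - 1) P_k)'` up to a constant factor, so by Rolle's theorem each step adds a real
  root.

* The lattice sum. Differentiating the partial fractions of the cotangent on the upper half plane
  and passing to real `p` gives
  `(2m - 1)! ∑ 1 / (p + n) ^ (2m) = (2πi) ^ (2m) λ E_k(λ) / (1 - λ) ^ (2m)` with `λ = exp (2πip)`
  (`tsum_one_div_real_add_pow`). At `p = -σh` this is a constant times
  the reciprocal of the rational function above. The sum is
  positive, which also shows that `E_k` has no zeros on the unit circle.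

When `σh` is an integer, `μ = 1` and the symbol vanishes because `E_k(1) ≠ 0`.
-/

open Polynomial

/-! ### Coefficients of the Euler-Frobenius polynomials -/

lemma eulerFrobenius_coeff_zero (k : ℕ) : (eulerFrobenius k).coeff 0 = 1 := by
  induction k with
  | zero => simp [eulerFrobenius]
  | succ k ih => simp [eulerFrobenius, mul_coeff_zero, ih]

lemma eulerFrobenius_coeff_succ (k n : ℕ) :
    (eulerFrobenius (k + 1)).coeff (n + 1) =
      (n + 2) * (eulerFrobenius k).coeff (n + 1)
        + ((k : ℤ) + 1 - n) * (eulerFrobenius k).coeff n := by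
  have h : eulerFrobenius (k + 1) = eulerFrobenius k
      + ((k : ℤ[X]) + 1) * (eulerFrobenius k * X)
      + derivative (eulerFrobenius k) * X - derivative (eulerFrobenius k) * X * X := by
    rw [eulerFrobenius]; ring
  have hc : ((k : ℤ[X]) + 1) = C ((k : ℤ) + 1) := by simp
  rw [h, hc]
  simp only [coeff_add, coeff_sub, coeff_C_mul, coeff_mul_X, coeff_derivative]
  cases n with
  | zero => simp; ring
  | succ n => simp only [coeff_mul_X, coeff_derivative]; push_cast; ring

lemma eulerFrobenius_coeff_of_lt {k n : ℕ} (h : k < n) : (eulerFrobenius k).coeff n = 0 := by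
  induction k generalizing n with
  | zero => rw [eulerFrobenius, coeff_one, if_neg (by omega)]
  | succ k ih =>
    obtain ⟨n, rfl⟩ : ∃ j, n = j + 1 := ⟨n - 1, by omega⟩
    rw [eulerFrobenius_coeff_succ, ih (by omega), ih (by omega)]
    simp

/-- `E_k` is palindromic. -/
lemma eulerFrobenius_coeff_symm {k i j : ℕ} (h : i + j = k) :
    (eulerFrobenius k).coeff i = (eulerFrobenius k).coeff j := by
  induction k generalizing i j with
  | zero => obtain ⟨rfl, rfl⟩ : i = 0 ∧ j = 0 := by omega
            rfl
  | succ k ih =>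
    -- the outer coefficients `0` and `k + 1` escape the three-term recursion
    have hend : (eulerFrobenius (k + 1)).coeff (k + 1) = 1 := by
      rw [eulerFrobenius_coeff_succ, eulerFrobenius_coeff_of_lt (Nat.lt_succ_self k),
        ih (i := k) (j := 0) (by omega), eulerFrobenius_coeff_zero]
      ring
    rcases i with _ | i
    · obtain rfl : j = k + 1 := by omega
      rw [hend, eulerFrobenius_coeff_zero]
    · rcases j with _ | j
      · obtain rfl : i = k := by omega
        rw [hend, eulerFrobenius_coeff_zero]
      · rw [eulerFrobenius_coeff_succ, eulerFrobenius_coeff_succ,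
          ih (i := i + 1) (j := j) (by omega), ih (i := i) (j := j + 1) (by omega)]
        obtain rfl : k = i + j + 1 := by omega
        push_cast
        ring

lemma eulerFrobenius_coeff_self (k : ℕ) : (eulerFrobenius k).coeff k = 1 := by
  rw [eulerFrobenius_coeff_symm (j := 0) (by omega), eulerFrobenius_coeff_zero]

lemma eulerFrobenius_natDegree (k : ℕ) : (eulerFrobenius k).natDegree = k :=
  natDegree_eq_of_le_of_coeff_ne_zero
    (natDegree_le_iff_coeff_eq_zero.2 fun _ h => eulerFrobenius_coeff_of_lt h)
    (by rw [eulerFrobenius_coeff_self]; exact one_ne_zero)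

lemma eulerFrobenius_monic (k : ℕ) : (eulerFrobenius k).Monic := by
  rw [Monic, leadingCoeff, eulerFrobenius_natDegree, eulerFrobenius_coeff_self]

lemma eulerFrobenius_coeff_one (k : ℕ) : (eulerFrobenius k).coeff 1 = 2 ^ (k + 1) - k - 2 := by
  induction k with
  | zero => simp [eulerFrobenius, coeff_one]
  | succ k ih =>
    rw [eulerFrobenius_coeff_succ, ih, eulerFrobenius_coeff_zero]
    push_cast
    ring

/-- The subleading coefficient of `E_k`, read off from `E_k * X` so that `k = 0` is covered. -/
lemma eulerFrobenius_mul_X_coeff (k : ℕ) :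
    (eulerFrobenius k * X).coeff k = (2 : ℤ) ^ (k + 1) - k - 2 := by
  cases k with
  | zero => simp
  | succ k =>
    rw [coeff_mul_X, eulerFrobenius_coeff_symm (j := 1) (by omega), eulerFrobenius_coeff_one]

lemma eulerFrobenius_reverse (k : ℕ) : (eulerFrobenius k).reverse = eulerFrobenius k := by
  ext n
  rw [coeff_reverse, eulerFrobenius_natDegree]
  rcases le_or_gt n k with h | h
  · rw [revAt_le h]
    exact eulerFrobenius_coeff_symm (by omega)
  · rw [revAt_eq_self_of_lt h]

lemma aeval_inv_eulerFrobenius (k : ℕ) {x : ℂ} (hx : x ≠ 0) :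
    aeval x⁻¹ (eulerFrobenius k) * x ^ k = aeval x (eulerFrobenius k) := by
  let _ := invertibleOfNonzero hx
  have h := eval₂_reverse_mul_pow (algebraMap ℤ ℂ) x (eulerFrobenius k)
  rwa [eulerFrobenius_reverse, eulerFrobenius_natDegree, invOf_eq_inv] at h

lemma aeval_zero_eulerFrobenius (k : ℕ) : aeval (0 : ℂ) (eulerFrobenius k) = 1 := by
  rw [← coeff_zero_eq_aeval_zero', eulerFrobenius_coeff_zero]; simp

lemma aeval_eulerFrobenius_succ (k : ℕ) (x : ℂ) :
    aeval x (eulerFrobenius (k + 1)) = (1 + ((k : ℂ) + 1) * x) * aeval x (eulerFrobenius k)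
      + x * (1 - x) * aeval x (derivative (eulerFrobenius k)) := by
  simp [eulerFrobenius]

lemma aeval_one_eulerFrobenius_ne_zero (k : ℕ) : aeval (1 : ℂ) (eulerFrobenius k) ≠ 0 := by
  induction k with
  | zero => simp [eulerFrobenius]
  | succ k ih =>
    rw [aeval_eulerFrobenius_succ]
    have : (1 + ((k : ℂ) + 1)) ≠ 0 := by norm_cast
    simpa [this] using ih

/-- Differentiating the reciprocity relation at a root. -/
lemma aeval_inv_derivative_eulerFrobenius {k : ℕ} {x : ℂ} (hx : x ≠ 0)
    (h0 : aeval x (eulerFrobenius k) = 0) :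
    aeval x⁻¹ (derivative (eulerFrobenius k)) * x ^ k
      = -x ^ 2 * aeval x (derivative (eulerFrobenius k)) := by
  have h1 : HasDerivAt (fun y : ℂ => aeval y⁻¹ (eulerFrobenius k) * y ^ k)
      (aeval x⁻¹ (derivative (eulerFrobenius k)) * (-(x ^ 2)⁻¹) * x ^ k
        + aeval x⁻¹ (eulerFrobenius k) * (k * x ^ (k - 1))) x :=
    ((Polynomial.hasDerivAt_aeval (eulerFrobenius k) x⁻¹).comp x (hasDerivAt_inv hx)).mul
      (hasDerivAt_pow k x)
  have h2 : HasDerivAt (fun y : ℂ => aeval y⁻¹ (eulerFrobenius k) * y ^ k)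
      (aeval x (derivative (eulerFrobenius k))) x := by
    refine (Polynomial.hasDerivAt_aeval (eulerFrobenius k) x).congr_of_eventuallyEq ?_
    filter_upwards [isOpen_ne.mem_nhds hx] with y hy using aeval_inv_eulerFrobenius k hy
  have h3 : aeval x⁻¹ (eulerFrobenius k) = 0 := by
    have := aeval_inv_eulerFrobenius k hx
    rw [h0] at this
    exact (mul_eq_zero.1 this).resolve_right (pow_ne_zero _ hx)
  have h4 := h1.unique h2
  rw [h3] at h4
  rw [← h4]
  field_simp
  ring

/-! ### Simplicity of the roots -/

/-- The polynomials `P_0 = 1`, `P_{k+1} = ((X² - 1) P_k)'`, with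
`P_k(y) = (y + 1)^k E_k((y - 1) / (y + 1))`: they describe `E_k` in the variable
`y = (1 + x) / (1 - x)`, where `x d/dx` becomes `((y² - 1) / 2) d/dy`. The factors `1 / 2` are
dropped. -/
noncomputable def cayleyEulerFrobenius : ℕ → ℝ[X]
  | 0 => 1
  | k + 1 => derivative ((X ^ 2 - 1) * cayleyEulerFrobenius k)

lemma cayleyEulerFrobenius_eval (k : ℕ) {y : ℝ} (hy : y + 1 ≠ 0) :
    (cayleyEulerFrobenius k).eval y
      = aeval ((y - 1) / (y + 1)) (eulerFrobenius k) * (y + 1) ^ k := by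
  induction k generalizing y with
  | zero => simp [cayleyEulerFrobenius, eulerFrobenius]
  | succ k ih =>
    have h1 : HasDerivAt (fun y : ℝ => (y - 1) / (y + 1))
        ((1 * (y + 1) - (y - 1) * 1) / (y + 1) ^ 2) y :=
      ((hasDerivAt_id y).sub_const 1).div ((hasDerivAt_id y).add_const 1) hy
    have h2 : HasDerivAt (fun y : ℝ => (y + 1) ^ (k + 1)) ((k + 1 : ℕ) * (y + 1) ^ k * 1) y :=
      ((hasDerivAt_id y).add_const 1).pow (k + 1)
    -- `(y² - 1) P_k = (y - 1) (y + 1)^(k + 1) E_k`, differentiated in two ways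
    have h3 := (((hasDerivAt_id y).sub_const 1).mul h2).mul
      ((Polynomial.hasDerivAt_aeval (eulerFrobenius k) ((y - 1) / (y + 1))).comp y h1)
    have h4 : HasDerivAt (fun y => ((X ^ 2 - 1) * cayleyEulerFrobenius k).eval y)
        ((cayleyEulerFrobenius (k + 1)).eval y) y := by
      rw [cayleyEulerFrobenius]; exact Polynomial.hasDerivAt _ y
    have hopen : IsOpen {y : ℝ | y + 1 ≠ 0} :=
      isOpen_ne_fun (by fun_prop) continuous_const
    have hev : (fun y => ((X ^ 2 - 1) * cayleyEulerFrobenius k).eval y) =ᶠ[nhds y]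
        ((fun x => id x - 1) * fun y => (y + 1) ^ (k + 1)) *
          (fun x => aeval x (eulerFrobenius k)) ∘ fun y => (y - 1) / (y + 1) := by
      filter_upwards [hopen.mem_nhds hy] with z hz
      simp only [eval_mul, eval_sub, eval_pow, eval_X, eval_one, ih hz, Pi.mul_apply, id,
        Function.comp]
      ring
    rw [h4.unique (h3.congr_of_eventuallyEq hev)]
    simp only [eulerFrobenius, map_add, map_mul, map_sub, map_one, aeval_X, map_natCast, id,
      Pi.mul_apply, Function.comp]
    push_cast
    field_simp
    ring

lemma cayleyEulerFrobenius_eval_succ (k : ℕ) (y : ℝ) :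
    (cayleyEulerFrobenius (k + 1)).eval y = 2 * y * (cayleyEulerFrobenius k).eval y
      + (y ^ 2 - 1) * (derivative (cayleyEulerFrobenius k)).eval y := by
  rw [cayleyEulerFrobenius, derivative_mul, eval_add, eval_mul, eval_mul]
  simp [one_add_one_eq_two]

lemma cayleyEulerFrobenius_eval_one_ne_zero (k : ℕ) : (cayleyEulerFrobenius k).eval 1 ≠ 0 := by
  induction k with
  | zero => simp [cayleyEulerFrobenius]
  | succ k ih => simpa [cayleyEulerFrobenius_eval_succ] using ih

lemma cayleyEulerFrobenius_eval_neg_one_ne_zero (k : ℕ) :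
    (cayleyEulerFrobenius k).eval (-1) ≠ 0 := by
  induction k with
  | zero => simp [cayleyEulerFrobenius]
  | succ k ih => simpa [cayleyEulerFrobenius_eval_succ] using ih

/-- By Rolle's theorem `((X² - 1) P_k)'` has one root more than `P_k`, since multiplying by
`X² - 1` adds the two new roots `±1`. -/
lemma le_card_roots_cayleyEulerFrobenius (k : ℕ) :
    k ≤ (cayleyEulerFrobenius k).roots.toFinset.card := by
  induction k with
  | zero => simp
  | succ k ih =>
    have h0 : cayleyEulerFrobenius k ≠ 0 := fun h =>
      cayleyEulerFrobenius_eval_one_ne_zero k (by simp [h])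
    have hX : (X ^ 2 - 1 : ℝ[X]) ≠ 0 := (monic_X_pow_sub_C (1 : ℝ) two_ne_zero).ne_zero
    have h1 := card_roots_toFinset_le_derivative ((X ^ 2 - 1) * cayleyEulerFrobenius k)
    have hsub : insert 1 (insert (-1) (cayleyEulerFrobenius k).roots.toFinset)
        ⊆ ((X ^ 2 - 1) * cayleyEulerFrobenius k).roots.toFinset := by
      intro y hy
      simp only [Finset.mem_insert, Multiset.mem_toFinset, mem_roots', ne_eq, IsRoot.def] at hy ⊢
      refine ⟨mul_ne_zero hX h0, ?_⟩
      rcases hy with rfl | rfl | hy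
      · simp
      · simp
      · simp [hy.2]
    have h2 := Finset.card_le_card hsub
    rw [Finset.card_insert_of_notMem, Finset.card_insert_of_notMem] at h2
    · rw [cayleyEulerFrobenius]
      omega
    · simp [h0, cayleyEulerFrobenius_eval_neg_one_ne_zero]
    · have : (1 : ℝ) ≠ -1 := by norm_num
      simp [h0, cayleyEulerFrobenius_eval_one_ne_zero, this]

/-- All roots of `E_k` are real and simple, so it has `k` distinct complex roots. -/
lemma card_aroots_eulerFrobenius (k : ℕ) :
    ((eulerFrobenius k).aroots ℂ).toFinset.card = k := by
  apply le_antisymm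
  · refine (Multiset.toFinset_card_le _).trans ((card_roots' _).trans ?_)
    exact natDegree_map_le.trans (eulerFrobenius_natDegree k).le
  · refine (le_card_roots_cayleyEulerFrobenius k).trans ?_
    have hne : ∀ y ∈ (cayleyEulerFrobenius k).roots.toFinset, y + 1 ≠ 0 := by
      intro y hy h
      obtain rfl : y = -1 := by linarith
      exact cayleyEulerFrobenius_eval_neg_one_ne_zero k
        (by simpa using And.right (by simpa using hy))
    refine Finset.card_le_card_of_injOn (fun y => (((y - 1) / (y + 1) : ℝ) : ℂ)) ?_ ?_
    · intro y hy
      have hy' := hne y hy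
      have h1 : (cayleyEulerFrobenius k).eval y = 0 := by
        simpa using And.right (by simpa using hy)
      rw [cayleyEulerFrobenius_eval k hy'] at h1
      have h2 := (mul_eq_zero.1 h1).resolve_right (pow_ne_zero _ hy')
      rw [Finset.mem_coe, Multiset.mem_toFinset, mem_aroots]
      refine ⟨(eulerFrobenius_monic k).ne_zero, ?_⟩
      have h3 := aeval_algebraMap_apply ℂ ((y - 1) / (y + 1)) (eulerFrobenius k)
      rw [h2, map_zero] at h3
      exact h3
    · intro y hy z hz hyz
      have hy' := hne y hy
      have hz' := hne z hz
      have h1 := Complex.ofReal_injective hyz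
      rw [div_eq_div_iff hy' hz'] at h1
      linarith

lemma nodal_aroots_eulerFrobenius (k : ℕ) :
    Lagrange.nodal ((eulerFrobenius k).aroots ℂ).toFinset id
      = (eulerFrobenius k).map (algebraMap ℤ ℂ) := by
  have hm : ((eulerFrobenius k).map (algebraMap ℤ ℂ)).Monic := (eulerFrobenius_monic k).map _
  have hd : ((eulerFrobenius k).map (algebraMap ℤ ℂ)).natDegree = k := by
    rw [(eulerFrobenius_monic k).natDegree_map, eulerFrobenius_natDegree]
  have hcard : ((eulerFrobenius k).aroots ℂ).card = k :=
    le_antisymm ((card_roots' _).trans hd.le)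
      ((card_aroots_eulerFrobenius k).symm.le.trans (Multiset.toFinset_card_le _))
  have hnd : ((eulerFrobenius k).aroots ℂ).Nodup := by
    rw [← Multiset.toFinset_card_eq_card_iff_nodup, hcard, card_aroots_eulerFrobenius]
  conv_rhs => rw [← prod_multiset_X_sub_C_of_monic_of_roots_card_eq hm (hcard.trans hd.symm)]
  rw [Lagrange.nodal_eq, Finset.prod, Multiset.toFinset_val, hnd.dedup]
  rfl

/-! ### The sum of `1 / (z + n) ^ (k + 2)` over the integers -/

open UpperHalfPlane in
/-- Iterated derivatives of `π cot (π z) = -π i (1 + λ) / (1 - λ)`, `λ = exp (2πiz)`: since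
`d/dz = 2πi λ d/dλ`, they are given by the Euler-Frobenius polynomials. -/
lemma iteratedDerivWithin_pi_mul_cot_eq_eulerFrobenius (k : ℕ) :
    Set.EqOn (iteratedDerivWithin (k + 1)
        (fun x : ℂ => (Real.pi : ℂ) * Complex.cot (Real.pi * x)) upperHalfPlaneSet)
      (fun z => -(2 * Real.pi * Complex.I) ^ (k + 2) *
        (Complex.exp (2 * Real.pi * Complex.I * z)
          * aeval (Complex.exp (2 * Real.pi * Complex.I * z)) (eulerFrobenius k)
          / (1 - Complex.exp (2 * Real.pi * Complex.I * z)) ^ (k + 2)))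
      upperHalfPlaneSet := by
  have hne : ∀ z ∈ upperHalfPlaneSet, 1 - Complex.exp (2 * Real.pi * Complex.I * z) ≠ 0 := by
    intro z hz h
    have := norm_exp_two_pi_I_lt_one ⟨z, hz⟩
    rw [show Complex.exp (2 * Real.pi * Complex.I * ((⟨z, hz⟩ : ℍ) : ℂ)) = 1 from
      (sub_eq_zero.1 h).symm] at this
    simp at this
  have hexp : ∀ z, HasDerivAt (fun z => Complex.exp (2 * Real.pi * Complex.I * z))
      (Complex.exp (2 * Real.pi * Complex.I * z) * (2 * Real.pi * Complex.I * 1)) z := fun z =>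
    ((hasDerivAt_id z).const_mul _).cexp
  have hstep : ∀ (n : ℕ) (f g g' : ℂ → ℂ),
      Set.EqOn (iteratedDerivWithin n f upperHalfPlaneSet) g upperHalfPlaneSet →
      (∀ z ∈ upperHalfPlaneSet, HasDerivAt g (g' z) z) →
      Set.EqOn (iteratedDerivWithin (n + 1) f upperHalfPlaneSet) g' upperHalfPlaneSet := by
    intro n f g g' h1 h2 z hz
    rw [iteratedDerivWithin_succ, derivWithin_congr h1 (h1 hz)]
    exact (h2 z hz).hasDerivWithinAt.derivWithin
      (isOpen_upperHalfPlaneSet.uniqueDiffWithinAt hz)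
  induction k with
  | zero =>
    refine hstep 0 _ (fun z => Real.pi * ((Complex.exp (2 * Real.pi * Complex.I * z) + 1)
      / (Complex.I * (1 - Complex.exp (2 * Real.pi * Complex.I * z))))) _ ?_ ?_
    · intro z _
      rw [iteratedDerivWithin_zero]
      simp only [Complex.cot_pi_eq_exp_ratio]
    · intro z hz
      have h1 := hne z hz
      have h := (((hexp z).add_const 1).div (((hexp z).const_sub 1).const_mul Complex.I)
        (mul_ne_zero Complex.I_ne_zero h1)).const_mul (Real.pi : ℂ)
      refine h.congr_deriv ?_
      simp only [eulerFrobenius, map_one]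
      generalize Complex.exp (2 * Real.pi * Complex.I * z) = w at *
      field_simp
      rw [zero_add, mul_pow _ Complex.I, Complex.I_sq]
      ring
  | succ k ih =>
    refine hstep (k + 1) _ _ _ ih ?_
    intro z hz
    have h1 := hne z hz
    have h2 : HasDerivAt (fun y : ℂ => (1 - y) ^ (k + 2))
        (((k + 2 : ℕ) : ℂ) * (1 - Complex.exp (2 * Real.pi * Complex.I * z)) ^ (k + 1) * (-1))
        (Complex.exp (2 * Real.pi * Complex.I * z)) :=
      ((hasDerivAt_id _).const_sub 1).pow (k + 2)
    have h3 := ((((hasDerivAt_id _).mul (Polynomial.hasDerivAt_aeval (eulerFrobenius k) _)).div h2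
      (pow_ne_zero _ h1)).comp z (hexp z)).const_mul (-(2 * Real.pi * Complex.I) ^ (k + 2))
    refine h3.congr_deriv ?_
    rw [aeval_eulerFrobenius_succ]
    simp only [Pi.mul_apply, id_eq]
    generalize Complex.exp (2 * Real.pi * Complex.I * z) = w at *
    push_cast
    field_simp
    ring

lemma summable_one_div_int_add_pow {k : ℕ} (hk : 2 ≤ k) (p : ℝ) :
    Summable fun n : ℤ => 1 / |p + n| ^ k := by
  have h := (EisensteinSeries.linear_right_summable (p : ℂ) 1 (k := k) (by exact_mod_cast hk)).norm
  refine h.congr fun n => ?_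
  rw [← Real.norm_eq_abs, ← Complex.norm_real]
  simp

/-- The Lipschitz summation formula on the real line, as the boundary value of the identity on
the upper half plane. -/
lemma tsum_one_div_real_add_pow (k : ℕ) {p : ℝ} (hp : ∀ n : ℤ, p + n ≠ 0) :
    (-1) ^ (k + 1) * ((k + 1).factorial : ℂ) * ∑' n : ℤ, 1 / ((p : ℂ) + n) ^ (k + 2)
      = -(2 * Real.pi * Complex.I) ^ (k + 2) *
        (Complex.exp (2 * Real.pi * Complex.I * p)
          * aeval (Complex.exp (2 * Real.pi * Complex.I * p)) (eulerFrobenius k)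
          / (1 - Complex.exp (2 * Real.pi * Complex.I * p)) ^ (k + 2)) := by
  have hne : 1 - Complex.exp (2 * Real.pi * Complex.I * p) ≠ 0 := by
    intro h
    obtain ⟨n, hn⟩ := Complex.exp_eq_one_iff.1 (sub_eq_zero.1 h).symm
    have h2 : (p : ℂ) = n := by
      have := Complex.two_pi_I_ne_zero
      apply mul_left_cancel₀ this
      rw [hn]; ring
    apply hp (-n)
    have : p = n := by exact_mod_cast h2
    simp [this]
  let c : ℝ → ℂ := fun ε => p + ε * Complex.I
  have hc : Filter.Tendsto c (nhdsWithin 0 (Set.Ioi 0)) (nhds p) := by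
    have : Continuous c := by fun_prop
    have h := this.tendsto 0
    simp only [c, Complex.ofReal_zero, zero_mul, add_zero] at h
    exact h.mono_left nhdsWithin_le_nhds
  have hpn : ∀ n : ℤ, (p : ℂ) + n ≠ 0 := fun n => by exact_mod_cast hp n
  have hsum : Filter.Tendsto (fun ε => ∑' n : ℤ, 1 / (c ε + n) ^ (k + 2))
      (nhdsWithin 0 (Set.Ioi 0)) (nhds (∑' n : ℤ, 1 / ((p : ℂ) + n) ^ (k + 2))) := by
    refine tendsto_tsum_of_dominated_convergence
      (summable_one_div_int_add_pow (k := k + 2) (by omega) p) ?_ ?_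
    · intro n
      exact tendsto_const_nhds.div ((hc.add_const _).pow _) (pow_ne_zero _ (hpn n))
    · refine Filter.Eventually.of_forall fun ε n => ?_
      rw [norm_div, norm_one, norm_pow]
      have h1 : |p + n| ≤ ‖c ε + n‖ := by
        have := Complex.abs_re_le_norm (c ε + n)
        simpa [c] using this
      have h2 : 0 < |p + n| := abs_pos.2 (hp n)
      gcongr
  have hlim := hsum.const_mul ((-1) ^ (k + 1) * ((k + 1).factorial : ℂ))
  have hexp : Filter.Tendsto (fun ε => Complex.exp (2 * Real.pi * Complex.I * c ε))
      (nhdsWithin 0 (Set.Ioi 0)) (nhds (Complex.exp (2 * Real.pi * Complex.I * p))) :=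
    (hc.const_mul _).cexp
  have hE : Filter.Tendsto
      (fun ε => aeval (Complex.exp (2 * Real.pi * Complex.I * c ε)) (eulerFrobenius k))
      (nhdsWithin 0 (Set.Ioi 0))
      (nhds (aeval (Complex.exp (2 * Real.pi * Complex.I * p)) (eulerFrobenius k))) :=
    ((Polynomial.continuous_aeval (eulerFrobenius k)).tendsto _).comp hexp
  have hlim' := ((hexp.mul hE).div ((hexp.const_sub 1).pow (k + 2))
    (pow_ne_zero _ hne)).const_mul (-(2 * Real.pi * Complex.I) ^ (k + 2))
  refine tendsto_nhds_unique hlim (hlim'.congr' ?_)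
  filter_upwards [self_mem_nhdsWithin] with ε hε
  have hmem : c ε ∈ UpperHalfPlane.upperHalfPlaneSet := by
    simpa [c, UpperHalfPlane.upperHalfPlaneSet] using hε
  have h1 := iteratedDerivWithin_pi_mul_cot_eq_eulerFrobenius k hmem
  have h2 := iteratedDerivWithin_cot_pi_mul_eq_mul_tsum_div_pow (k := k + 1) (by omega) hmem
  exact h1.symm.trans h2

lemma summable_one_div_real_add_pow {k : ℕ} (hk : Even k) (p : ℝ) :
    Summable fun n : ℤ => 1 / (p + n) ^ (k + 2) := by
  have he : Even (k + 2) := hk.add even_two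
  refine (summable_one_div_int_add_pow (k := k + 2) (by omega) p).congr fun n => ?_
  rw [he.pow_abs]

lemma tsum_one_div_real_add_pow_pos {k : ℕ} (hk : Even k) {p : ℝ} (hp : ∀ n : ℤ, p + n ≠ 0) :
    0 < ∑' n : ℤ, 1 / (p + n) ^ (k + 2) := by
  have he : Even (k + 2) := hk.add even_two
  have h := summable_one_div_real_add_pow hk p
  refine h.tsum_pos (fun n => one_div_nonneg.2 (he.pow_nonneg _)) 0 (one_div_pos.2 ?_)
  exact he.pow_pos (hp 0)

/-- For even `k`, `E_k` has no zeros on the unit circle: at `exp (2πip)` with `p` not an integer it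
is a nonzero multiple of the positive number `∑ 1 / (p + n) ^ (k + 2)`. -/
lemma aeval_eulerFrobenius_ne_zero_of_norm_eq_one {k : ℕ} (hk : Even k) {x : ℂ} (hx : ‖x‖ = 1) :
    aeval x (eulerFrobenius k) ≠ 0 := by
  intro h0
  obtain ⟨p, rfl⟩ : ∃ p : ℝ, Complex.exp (2 * Real.pi * Complex.I * p) = x := by
    refine ⟨x.arg / (2 * Real.pi), ?_⟩
    conv_rhs => rw [← Complex.norm_mul_exp_arg_mul_I x, hx]
    have hpi : (Real.pi : ℂ) ≠ 0 := by exact_mod_cast Real.pi_ne_zero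
    rw [Complex.ofReal_one, one_mul]
    congr 1
    push_cast
    field_simp
  by_cases hp : ∀ n : ℤ, p + n ≠ 0
  · have h1 := tsum_one_div_real_add_pow k hp
    rw [h0] at h1
    have h2 : ∑' n : ℤ, 1 / ((p : ℂ) + n) ^ (k + 2)
        = ((∑' n : ℤ, 1 / (p + n) ^ (k + 2) : ℝ) : ℂ) := by
      push_cast; rfl
    have h3 : ((∑' n : ℤ, 1 / (p + n) ^ (k + 2) : ℝ) : ℂ) ≠ 0 := by
      exact_mod_cast (tsum_one_div_real_add_pow_pos hk hp).ne'
    rw [h2] at h1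
    simp only [mul_zero, zero_div, mul_eq_zero, h3, or_false, pow_eq_zero_iff', neg_eq_zero,
      one_ne_zero, false_and, false_or, Nat.cast_eq_zero] at h1
    exact Nat.factorial_ne_zero _ h1
  · push Not at hp
    obtain ⟨n, hn⟩ := hp
    have h1 : Complex.exp (2 * Real.pi * Complex.I * p) = 1 := by
      rw [Complex.exp_eq_one_iff]
      refine ⟨-n, ?_⟩
      rw [show p = ((-n : ℤ) : ℝ) by push_cast; linarith]
      push_cast
      ring
    rw [h1] at h0
    exact aeval_one_eulerFrobenius_ne_zero k h0

/-! ### Partial fractions of the symbol -/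

/-- `X² - 2^(k+1) X + 1` agrees with the polynomial part of `(X - 1)^(k+2) / E_k` up to the constant
term, so that the remainder has degree at most `k`. Its constant term `1` makes the remainder vanish
at `0` for even `k`. -/
lemma degree_remainder_lt (k : ℕ) :
    ((X - 1) ^ (k + 2) - (eulerFrobenius k * X * X
      - C (2 ^ (k + 1)) * (eulerFrobenius k * X) + eulerFrobenius k) : ℤ[X]).degree
      < (k + 1 : ℕ) := by
  rw [degree_lt_iff_coeff_zero]
  intro n hn
  obtain ⟨n, rfl⟩ : ∃ j, n = j + 1 := ⟨n - 1, by omega⟩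
  rw [coeff_sub, coeff_add, coeff_sub, coeff_C_mul, coeff_mul_X, coeff_mul_X,
    eulerFrobenius_coeff_of_lt (n := n + 1) (by omega),
    show (X - 1 : ℤ[X]) = X + C (-1) by simp [sub_eq_add_neg], coeff_X_add_C_pow]
  rcases eq_or_lt_of_le (show k ≤ n by omega) with rfl | h1
  · rw [eulerFrobenius_mul_X_coeff, eulerFrobenius_coeff_self,
      show k + 2 - (k + 1) = 1 by omega,
      Nat.choose_symm_of_eq_add (show k + 2 = k + 1 + 1 by omega), Nat.choose_one_right]
    push_cast
    ring
  · obtain ⟨n, rfl⟩ : ∃ j, n = j + 1 := ⟨n - 1, by omega⟩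
    rw [coeff_mul_X, eulerFrobenius_coeff_of_lt (n := n + 1) (by omega)]
    rcases eq_or_lt_of_le (show k ≤ n by omega) with rfl | h2
    · simp [eulerFrobenius_coeff_self]
    · rw [eulerFrobenius_coeff_of_lt h2, Nat.choose_eq_zero_of_lt (by omega)]
      simp

/-- The partial fraction expansion of `(1 - μ)^(k+2) / (μ E_k(μ))`. -/
lemma partialFraction_eulerFrobenius {k : ℕ} (hk : Even k) {μ : ℂ} (hμ : μ ≠ 0)
    (hE : aeval μ (eulerFrobenius k) ≠ 0) :
    (1 - μ) ^ (k + 2) / (μ * aeval μ (eulerFrobenius k))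
      = μ + μ⁻¹ - 2 ^ (k + 1)
        + ∑ r ∈ ((eulerFrobenius k).aroots ℂ).toFinset,
            (1 - r) ^ (k + 2) / (r * aeval r (derivative (eulerFrobenius k))) / (μ - r) := by
  classical
  set s := ((eulerFrobenius k).aroots ℂ).toFinset with hs
  set E := eulerFrobenius k with hEdef
  have hroot : ∀ r ∈ s, aeval r E = 0 := by
    intro r hr
    rw [hs, Multiset.mem_toFinset, mem_aroots] at hr
    exact hr.2
  have h0s : (0 : ℂ) ∉ s := by
    intro h
    have := hroot 0 h
    rw [aeval_zero_eulerFrobenius] at this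
    exact one_ne_zero this
  have hμs : μ ∉ s := fun h => hE (hroot μ h)
  set R : ℤ[X] := (X - 1) ^ (k + 2) - (E * X * X - C (2 ^ (k + 1)) * (E * X) + E) with hR
  have hReval : ∀ x : ℂ, (R.map (algebraMap ℤ ℂ)).eval x
      = (1 - x) ^ (k + 2) - aeval x E * (x ^ 2 - 2 ^ (k + 1) * x + 1) := by
    intro x
    have he : (x - 1) ^ (k + 2) = (1 - x) ^ (k + 2) := by
      rw [← neg_sub, (hk.add even_two).neg_pow]
    rw [eval_map_algebraMap, hR]
    simp only [map_sub, map_add, map_mul, map_pow, aeval_X, map_one, he, map_ofNat]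
    ring
  have hnod : Lagrange.nodal (insert 0 s) id = X * E.map (algebraMap ℤ ℂ) := by
    rw [Lagrange.nodal_insert_eq_nodal h0s, hs, nodal_aroots_eulerFrobenius]
    simp [hEdef]
  have hdeg : (R.map (algebraMap ℤ ℂ)).degree < (insert 0 s).card := by
    rw [Finset.card_insert_of_notMem h0s, hs, card_aroots_eulerFrobenius]
    exact degree_map_le.trans_lt (degree_remainder_lt k)
  have hint := Lagrange.eq_interpolate (s := insert 0 s) (v := id)
    (Function.injective_id.injOn) hdeg
  have hx : ∀ i ∈ insert 0 s, μ ≠ id i := by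
    intro i hi h
    rw [id] at h
    subst h
    rcases Finset.mem_insert.1 hi with h | h
    exacts [hμ h, hμs h]
  have hev := Lagrange.eval_interpolate_not_at_node
    (fun i => (R.map (algebraMap ℤ ℂ)).eval (id i)) hx
  rw [← hint, hReval, hnod, Finset.sum_insert h0s] at hev
  -- the node `0` does not contribute, because the remainder vanishes there
  have hR0 : (R.map (algebraMap ℤ ℂ)).eval (id 0) = 0 := by
    rw [id, hReval, aeval_zero_eulerFrobenius]
    simp
  rw [hR0, mul_zero, zero_add, eval_mul, eval_X, eval_map_algebraMap] at hev
  have hterm : ∀ r ∈ s, Lagrange.nodalWeight (insert 0 s) id r * (μ - id r)⁻¹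
        * (R.map (algebraMap ℤ ℂ)).eval (id r)
      = (1 - r) ^ (k + 2) / (r * aeval r (derivative E)) / (μ - r) := by
    intro r hr
    rw [Lagrange.nodalWeight_eq_eval_derivative_nodal (Finset.mem_insert_of_mem hr), hnod]
    simp only [id]
    rw [hReval, hroot r hr, derivative_mul, derivative_X, one_mul, eval_add, eval_mul, eval_X,
      eval_map_algebraMap, hroot r hr, derivative_map, eval_map_algebraMap]
    simp only [zero_add, zero_mul, sub_zero, div_eq_mul_inv]
    ring
  rw [Finset.sum_congr rfl hterm] at hev
  have h1 : (1 - μ) ^ (k + 2) = aeval μ E * (μ ^ 2 - 2 ^ (k + 1) * μ + 1) + μ * aeval μ E *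
      ∑ r ∈ s, (1 - r) ^ (k + 2) / (r * aeval r (derivative E)) / (μ - r) := by
    rw [← hev]; ring
  rw [h1, add_div, mul_div_cancel_left₀ _ (mul_ne_zero hμ hE)]
  congr 1
  field_simp
  ring

/-- Each root `q` inside the unit disc is grouped with the root `1 / q` outside; for even `k` there
are none on the circle. -/
lemma sum_aroots_eulerFrobenius {k : ℕ} (hk : Even k) (f : ℂ → ℂ) :
    ∑ r ∈ ((eulerFrobenius k).aroots ℂ).toFinset, f r
      = ∑ q ∈ ((eulerFrobenius k).aroots ℂ).toFinset with ‖q‖ < 1, (f q + f q⁻¹) := by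
  set s := ((eulerFrobenius k).aroots ℂ).toFinset with hs
  have hmem : ∀ r, r ∈ s ↔ aeval r (eulerFrobenius k) = 0 := by
    intro r
    rw [hs, Multiset.mem_toFinset, mem_aroots]
    exact and_iff_right (eulerFrobenius_monic k).ne_zero
  have h0 : ∀ r ∈ s, r ≠ 0 := by
    rintro r hr rfl
    have := (hmem 0).1 hr
    rw [aeval_zero_eulerFrobenius] at this
    exact one_ne_zero this
  have hinv : ∀ r ∈ s, r⁻¹ ∈ s := by
    intro r hr
    have := aeval_inv_eulerFrobenius k (h0 r hr)
    rw [(hmem r).1 hr] at this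
    exact (hmem _).2 ((mul_eq_zero.1 this).resolve_right (pow_ne_zero _ (h0 r hr)))
  rw [Finset.sum_add_distrib, ← Finset.sum_filter_add_sum_filter_not s (fun q => ‖q‖ < 1)]
  congr 1
  refine Finset.sum_nbij' (·⁻¹) (·⁻¹) ?_ ?_ (fun _ _ => inv_inv _) (fun _ _ => inv_inv _)
    (fun _ _ => by rw [inv_inv])
  · intro r hr
    rw [Finset.mem_filter] at hr ⊢
    refine ⟨hinv r hr.1, ?_⟩
    have h1 : ‖r‖ ≠ 1 := fun h =>
      aeval_eulerFrobenius_ne_zero_of_norm_eq_one hk h ((hmem r).1 hr.1)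
    rw [norm_inv]
    exact inv_lt_one_of_one_lt₀ (lt_of_le_of_ne (not_lt.1 hr.2) h1.symm)
  · intro q hq
    rw [Finset.mem_filter] at hq ⊢
    refine ⟨hinv q hq.1, ?_⟩
    rw [norm_inv, not_lt]
    exact (one_le_inv₀ (norm_pos_iff.2 (h0 q hq.1))).2 hq.2.le

/-- The Poisson kernel as a Fourier series. -/
lemma hasSum_pow_natAbs_mul_zpow {q μ : ℂ} (hq : ‖q‖ < 1) (hμ : ‖μ‖ = 1) :
    HasSum (fun n : ℤ => q ^ n.natAbs * μ ^ n) ((1 - q * μ)⁻¹ + q * μ⁻¹ * (1 - q * μ⁻¹)⁻¹) := by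
  have hμ0 : μ ≠ 0 := by rintro rfl; simp at hμ
  refine HasSum.of_nat_of_neg_add_one ?_ ?_
  · have h : ‖q * μ‖ < 1 := by rwa [norm_mul, hμ, mul_one]
    refine (hasSum_geometric_of_norm_lt_one h).congr_fun fun n => ?_
    simp [mul_pow]
  · have h : ‖q * μ⁻¹‖ < 1 := by rwa [norm_mul, norm_inv, hμ, inv_one, mul_one]
    refine ((hasSum_geometric_of_norm_lt_one h).mul_left (q * μ⁻¹)).congr_fun fun n => ?_
    have h1 : (-((n : ℤ) + 1)).natAbs = n + 1 := by omega
    rw [h1, ← pow_succ', mul_pow, zpow_neg, inv_pow]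
    norm_cast

/-- The symbol of `D_h^{(m)}`, on the whole unit circle. -/
lemma hasSum_discreteD_mul_zpow {m : ℕ} (hm : 1 ≤ m) (h : ℝ) {μ : ℂ} (hμ : ‖μ‖ = 1) :
    HasSum (fun γ : ℤ => discreteD m h γ * μ ^ γ)
      (((2 * m - 1).factorial : ℂ) / (h : ℂ) ^ (2 * m) *
        ((1 - μ) ^ (2 * m) / (μ * aeval μ (eulerFrobenius (2 * m - 2))))) := by
  have hk : Even (2 * m - 2) := ⟨m - 1, by omega⟩
  have hμ0 : μ ≠ 0 := by rintro rfl; simp at hμ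
  have hE := aeval_eulerFrobenius_ne_zero_of_norm_eq_one hk hμ
  have hpf := partialFraction_eulerFrobenius hk hμ0 hE
  rw [sum_aroots_eulerFrobenius hk, show 2 * m - 2 + 2 = 2 * m by omega,
    show 2 * m - 2 + 1 = 2 * m - 1 by omega] at hpf
  rw [hpf]
  change HasSum _ (_ * (_ + ∑ q ∈ innerRoots m, _))
  have hq0 : ∀ q ∈ innerRoots m, q ≠ 0 := by
    rintro q hq rfl
    rw [innerRoots, Finset.mem_filter, Multiset.mem_toFinset, mem_aroots,
      aeval_zero_eulerFrobenius] at hq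
    exact one_ne_zero hq.1.2
  -- the part of `D` supported on `|γ| ≤ 1`
  have hfin : HasSum (fun γ : ℤ => (if γ = 0 then -2 ^ (2 * m - 1) else
      if |γ| = 1 then 1 else 0 : ℂ) * μ ^ γ) (μ + μ⁻¹ - 2 ^ (2 * m - 1)) := by
    have := hasSum_sum_of_ne_finset_zero (L := SummationFilter.unconditional ℤ)
      (s := {0, 1, -1}) (f := fun γ : ℤ =>
      (if γ = 0 then -2 ^ (2 * m - 1) else if |γ| = 1 then 1 else 0 : ℂ) * μ ^ γ) (by
        intro γ hγ
        simp only [Finset.mem_insert, Finset.mem_singleton, not_or] at hγ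
        rw [if_neg hγ.1, if_neg (by rw [abs_eq zero_le_one]; tauto), zero_mul])
    convert! this using 1
    simp
    ring
  have hsum := hasSum_sum (s := innerRoots m) (fun q hq =>
    (hasSum_pow_natAbs_mul_zpow (q := q) (by
      rw [innerRoots, Finset.mem_filter] at hq; exact hq.2) hμ).mul_left
      ((1 - q) ^ (2 * m + 1) / (q * aeval q (eulerFrobenius (2 * m - 1)))))
  have hall := (hfin.add hsum).mul_left (((2 * m - 1).factorial : ℂ) / (h : ℂ) ^ (2 * m))
  convert! hall using 1
  · funext γ
    rw [discreteD, mul_assoc, ← Finset.sum_congr rfl (fun q _ => mul_assoc _ _ _),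
      ← Finset.sum_mul, ← add_mul]
    congr 2
    split_ifs with h1 h2
    · subst h1
      simp
    · congr 1
      refine Finset.sum_congr rfl fun q hq => ?_
      have := hq0 q hq
      rw [show γ.natAbs = 1 by zify; exact h2, pow_one]
      field_simp
    · rw [zero_add]
      exact Finset.sum_congr rfl fun q hq => by ring
  · congr 2
    refine Finset.sum_congr rfl fun q hq => ?_
    have hq0 := hq0 q hq
    rw [innerRoots, Finset.mem_filter, Multiset.mem_toFinset, mem_aroots] at hq
    obtain ⟨⟨-, hroot⟩, hq1⟩ := hq
    have hμq : μ - q ≠ 0 := fun hc => by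
      rw [sub_eq_zero.1 hc] at hμ; linarith
    have hqμ : 1 - q * μ ≠ 0 := fun hc => by
      have := congrArg norm (sub_eq_zero.1 hc)
      rw [norm_mul, hμ, norm_one] at this; linarith
    have h1q : 1 - q ≠ 0 := fun hc => by
      rw [← sub_eq_zero.1 hc, norm_one] at hq1; exact lt_irrefl _ hq1
    have hqμ' : q * μ - 1 ≠ 0 := by rwa [← neg_sub, neg_ne_zero]
    -- `E_{2m-1}(q) = q (1 - q) E_{2m-2}'(q)` at a root `q` of `E_{2m-2}`
    have hsucc := aeval_eulerFrobenius_succ (2 * m - 2) q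
    rw [hroot, mul_zero, zero_add, show 2 * m - 2 + 1 = 2 * m - 1 by omega] at hsucc
    have hder := aeval_inv_derivative_eulerFrobenius hq0 hroot
    obtain ⟨k, hk⟩ : ∃ k, 2 * m = k + 2 := ⟨2 * m - 2, by omega⟩
    rw [hsucc]
    have hk2 : Even (k + 2) := hk ▸ even_two_mul m
    rw [show 2 * m - 2 = k by omega] at hder ⊢
    rw [hk]
    have hinv : (1 - q⁻¹) ^ (k + 2) = (1 - q) ^ (k + 2) / q ^ (k + 2) := by
      rw [← div_pow, ← hk2.neg_pow]
      congr 1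
      field_simp
      ring
    have hder' : aeval q⁻¹ (derivative (eulerFrobenius k))
        = -q ^ 2 * aeval q (derivative (eulerFrobenius k)) / q ^ k := by
      rw [← hder, mul_div_cancel_right₀ _ (pow_ne_zero _ hq0)]
    rw [hinv, hder']
    generalize aeval q (derivative (eulerFrobenius k)) = d
    rcases eq_or_ne d 0 with rfl | hd
    · simp
    have e1 : μ - q⁻¹ = (q * μ - 1) / q := by field_simp
    have e2 : 1 - q * μ⁻¹ = (μ - q) / μ := by field_simp
    rw [e1, e2]
    field_simp
    ring

/-! ### The convolution -/

theorem lemma5p2 (m : ℕ) (hm : 1 ≤ m) (h : ℝ) (hh : 0 < h) (σ : ℝ) :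
    (∀ β : ℤ, Summable fun γ : ℤ => discreteD m h γ * discreteExp σ h (β - γ)) ∧
    ((¬ ∃ n : ℤ, σ * h = n) →
      (Summable fun γ : ℤ => h ^ (2 * m) / ((γ : ℝ) - σ * h) ^ (2 * m)) ∧
      ∀ β : ℤ, discreteConv (discreteD m h) (discreteExp σ h) β
        = (-1) ^ m * (2 * (Real.pi : ℂ)) ^ (2 * m) * discreteExp σ h β
          * (((∑' γ : ℤ, h ^ (2 * m) / ((γ : ℝ) - σ * h) ^ (2 * m) : ℝ) : ℂ))⁻¹) ∧
    ((∃ n : ℤ, σ * h = n) →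
      ∀ β : ℤ, discreteConv (discreteD m h) (discreteExp σ h) β = 0) := by
  have hk : Even (2 * m - 2) := ⟨m - 1, by omega⟩
  have hk2 : 2 * m - 2 + 2 = 2 * m := by omega
  have hk1 : 2 * m - 2 + 1 = 2 * m - 1 := by omega
  set p : ℝ := -(σ * h) with hp
  set μ : ℂ := Complex.exp (2 * Real.pi * Complex.I * p) with hμdef
  have hμ : ‖μ‖ = 1 := by
    rw [hμdef, show 2 * (Real.pi : ℂ) * Complex.I * p = ((2 * Real.pi * p : ℝ) : ℂ) * Complex.I by
      push_cast; ring]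
    exact Complex.norm_exp_ofReal_mul_I _
  have hE := aeval_eulerFrobenius_ne_zero_of_norm_eq_one hk hμ
  have hμ0 : μ ≠ 0 := Complex.exp_ne_zero _
  have hsplit : ∀ β γ : ℤ, discreteD m h γ * discreteExp σ h (β - γ)
      = discreteExp σ h β * (discreteD m h γ * μ ^ γ) := by
    intro β γ
    have : discreteExp σ h (β - γ) = discreteExp σ h β * μ ^ γ := by
      rw [hμdef, ← Complex.exp_int_mul, discreteExp, discreteExp, ← Complex.exp_add, hp]
      congr 1
      push_cast
      ring
    rw [this]
    ring
  have hsum : ∀ β : ℤ, HasSum (fun γ : ℤ => discreteD m h γ * discreteExp σ h (β - γ)) _ :=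
    fun β => ((hasSum_discreteD_mul_zpow hm h hμ).mul_left (discreteExp σ h β)).congr_fun (hsplit β)
  refine ⟨fun β => (hsum β).summable, fun hσ => ?_, ?_⟩
  · have hpn : ∀ n : ℤ, p + n ≠ 0 := fun n hn => hσ ⟨n, by rw [hp] at hn; linarith⟩
    have hterm : ∀ γ : ℤ, h ^ (2 * m) * (1 / (p + γ) ^ (2 * m))
        = h ^ (2 * m) / ((γ : ℝ) - σ * h) ^ (2 * m) := fun γ => by
      rw [mul_one_div, hp, neg_add_eq_sub]
    have hs := summable_one_div_real_add_pow hk p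
    have hpos := tsum_one_div_real_add_pow_pos hk hpn
    have hlip := tsum_one_div_real_add_pow (2 * m - 2) hpn
    rw [hk2] at hs hpos hlip
    refine ⟨(hs.mul_left (h ^ (2 * m))).congr hterm, fun β => ?_⟩
    rw [discreteConv, (hsum β).tsum_eq, ← tsum_congr hterm, tsum_mul_left]
    -- `i ^ (2m) = (-1) ^ m`, and `k + 1 = 2m - 1` is odd
    rw [← hμdef, hk1, Odd.neg_one_pow (by exact ⟨m - 1, by omega⟩), mul_pow _ Complex.I,
      pow_mul Complex.I, Complex.I_sq] at hlip
    have hcast : ∑' n : ℤ, 1 / ((p : ℂ) + n) ^ (2 * m)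
        = ((∑' n : ℤ, 1 / (p + n) ^ (2 * m) : ℝ) : ℂ) := by
      push_cast; rfl
    rw [hcast] at hlip
    have hS : ((∑' n : ℤ, 1 / (p + n) ^ (2 * m) : ℝ) : ℂ) ≠ 0 := by exact_mod_cast hpos.ne'
    rw [Complex.ofReal_mul]
    generalize ((∑' n : ℤ, 1 / (p + n) ^ (2 * m) : ℝ) : ℂ) = S at hlip hS ⊢
    have hh0 : (h : ℂ) ≠ 0 := by exact_mod_cast hh.ne'
    have hfac : ((2 * m - 1).factorial : ℂ) ≠ 0 := by
      exact_mod_cast Nat.factorial_ne_zero _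
    -- otherwise the right-hand side of the Lipschitz formula is `x / 0 = 0`
    have hμ1 : (1 - μ) ^ (2 * m) ≠ 0 := by
      intro h0
      rw [h0, div_zero, mul_zero] at hlip
      simp [hfac, hS] at hlip
    push_cast
    field_simp at hlip ⊢
    linear_combination (-discreteExp σ h β) * hlip
  · rintro ⟨n, hn⟩ β
    have h1 : μ = 1 := by
      rw [hμdef, Complex.exp_eq_one_iff]
      refine ⟨-n, ?_⟩
      rw [hp, hn]
      push_cast
      ring
    rw [discreteConv, (hsum β).tsum_eq, h1, sub_self, zero_pow (by omega)]
    simp
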